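/- Let $m\ge 1$, $l\ge 0$, and let $(F;\partial_1,\dots,\partial_m)$ be a differential field of characteristic zero, i.e. a field with $m$ pairwise commuting derivations, such that $\partial_1,\dots,\partial_m$ are linearly independent over $F$. Let $T=(t_{ij})_{i,j=1,\dots,m}$ be a matrix of differential indeterminates over $F$ with the basic relations $\partial_k t_{ij}=\partial_i t_{kj}$ for all $i,j,k$, and let $t_{m+1},\dots,t_{m+l}$ be further independent differential indeterminates; that is, the differential ring $F\{T,t_{m+1},\dots,t_{m+l}\}$ is the quotient of the ring of differential polynomials over $F$ in $m^2+l$ differential indeterminates by the differential ideal generated by the elements $\partial_k t_{ij}-\partial_i t_{kj}$. It is an integral domain with $\det T\neq 0$; let $K$ be its field of fractions, with the extended derivations $\partial=(\partial_1,\dots,\partial_m)$, written as a column vector, and let $T^{-1}\partial$ denote the system of derivations $\sum_{j}(T^{-1})_{ij}\partial_j$, $i=1,\dots,m$, of $K$. Put $\mathbf e=(1,0,\dots,0)\in F^m$. For a differential polynomial $p=p^{\partial}\{t_1,\dots,t_{m+l}\}$ over $F$ in $m+l$ differential indeterminates, elements $y_1,\dots,y_{m+l}\in K$ and a commuting system $\delta=(\delta_1,\dots,\delta_m)$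 of derivations of $K$, let $p^{\delta}\{y_1,\dots,y_{m+l}\}\in K$ be obtained from $p$ by replacing every $\partial_1^{\alpha_1}\cdots\partial_m^{\alpha_m}t_i$ by $\delta_1^{\alpha_1}\cdots\delta_m^{\alpha_m}y_i$, keeping the coefficients of $p$. Then for every nonzero differential polynomial $p^{\partial}\{t_1,\dots,t_{m+l}\}$ over $F$: a) $p^{\partial}\{\mathbf eT,t_{m+1},\dots,t_{m+l}\}\neq 0$; b) $p^{T^{-1}\partial}\{\mathbf eT^{-1},t_{m+1},\dots,t_{m+l}\}\neq 0$; c) $p^{T^{-1}\partial}\{\mathbf eT,t_{m+1},\dots,t_{m+l}\}\neq 0$. -/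

import Mathlib

open scoped Matrix

noncomputable section

namespace DiffAlg

/-! ### Extending derivations -/

/-- A ring homomorphism `r ↦ r + (D r) ε` into the dual numbers is the same thing as a
derivation `D`; this extracts `D` from the homomorphism. -/
def derivationOfDual {R : Type*} [CommRing R] (h : R →+* DualNumber R)
    (hf : ∀ r, (h r).fst = r) : Derivation ℤ R R :=
  Derivation.mk'
    ((AddMonoidHom.mk' (fun r => (h r).snd) (fun a b => by simp)).toIntLinearMap)
    (fun a b => by simp [hf, mul_comm])

@[simp] theorem derivationOfDual_apply {R : Type*} [CommRing R] (h : R →+* DualNumber R)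
    (hf : ∀ r, (h r).fst = r) (r : R) : derivationOfDual h hf r = (h r).snd := rfl

/-- The ring homomorphism `r ↦ f r + f (D r) ε` attached to a derivation `D` of `R` and a ring
homomorphism `f : R → S`. -/
def dualOfDerivation {R S : Type*} [CommRing R] [CommRing S] (f : R →+* S)
    (D : Derivation ℤ R R) : R →+* DualNumber S where
  toFun r := TrivSqZeroExt.inl (f r) + TrivSqZeroExt.inr (f (D r))
  map_one' := by ext <;> simp
  map_zero' := by ext <;> simp
  map_mul' a b := by
    ext
    · simp
    · simp [mul_comm]
  map_add' a b := by ext <;> simp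

@[simp] theorem dualOfDerivation_fst {R S : Type*} [CommRing R] [CommRing S] (f : R →+* S)
    (D : Derivation ℤ R R) (r : R) : (dualOfDerivation f D r).fst = f r := by
  simp [dualOfDerivation]

@[simp] theorem dualOfDerivation_snd {R S : Type*} [CommRing R] [CommRing S] (f : R →+* S)
    (D : Derivation ℤ R R) (r : R) : (dualOfDerivation f D r).snd = f (D r) := by
  simp [dualOfDerivation]

/-- The derivation induced on a quotient ring `S` of `R`, given by a surjective homomorphism
`f : R → S`, by a derivation `D` of `R` that preserves the kernel of `f`. -/
def quotientDerivation {R S : Type*} [CommRing R] [CommRing S] (f : R →+* S)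
    (hf : Function.Surjective f) (D : Derivation ℤ R R)
    (hD : ∀ r, f r = 0 → f (D r) = 0) : Derivation ℤ S S :=
  derivationOfDual
    (f.liftOfSurjective hf ⟨dualOfDerivation f D, fun r hr => by
      rw [RingHom.mem_ker] at hr ⊢
      ext
      · simpa using hr
      · simpa using hD r hr⟩)
    (fun r => by
      obtain ⟨r, rfl⟩ := hf r
      rw [RingHom.liftOfRightInverse_comp_apply]
      simp)

@[simp] theorem quotientDerivation_apply {R S : Type*} [CommRing R] [CommRing S] (f : R →+* S)
    (hf : Function.Surjective f) (D : Derivation ℤ R R)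
    (hD : ∀ r, f r = 0 → f (D r) = 0) (r : R) :
    quotientDerivation f hf D hD (f r) = f (D r) := by
  rw [quotientDerivation, derivationOfDual_apply, RingHom.liftOfRightInverse_comp_apply]
  simp

/-- The extension of `r ↦ r + (D r) ε` to the ring of fractions `K` of `R`. -/
def fractionDual {R : Type*} [CommRing R] (K : Type*) [CommRing K] [Algebra R K]
    [IsFractionRing R K] (D : Derivation ℤ R R) : K →+* DualNumber K :=
  IsLocalization.lift (M := nonZeroDivisors R) (g := dualOfDerivation (algebraMap R K) D)
    (fun y => by
      rw [TrivSqZeroExt.isUnit_iff_isUnit_fst, dualOfDerivation_fst]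
      exact IsLocalization.map_units K y)

theorem fractionDual_algebraMap {R : Type*} [CommRing R] (K : Type*) [CommRing K]
    [Algebra R K] [IsFractionRing R K] (D : Derivation ℤ R R) (r : R) :
    fractionDual K D (algebraMap R K r) = dualOfDerivation (algebraMap R K) D r := by
  simp [fractionDual]

theorem fractionDual_fst {R : Type*} [CommRing R] (K : Type*) [CommRing K] [Algebra R K]
    [IsFractionRing R K] (D : Derivation ℤ R R) (x : K) : (fractionDual K D x).fst = x := by
  have key : (TrivSqZeroExt.fstHom K K K).toRingHom.comp (fractionDual K D) =
      RingHom.id _ := by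
    apply IsLocalization.ringHom_ext (nonZeroDivisors R)
    ext r
    simp [fractionDual_algebraMap]
  exact congrArg (fun φ : K →+* K => φ x) key

/-- The (unique) extension of a derivation of `R` to its ring of fractions `K`
(the quotient rule). -/
def fractionDerivation {R : Type*} [CommRing R] (K : Type*) [CommRing K] [Algebra R K]
    [IsFractionRing R K] (D : Derivation ℤ R R) : Derivation ℤ K K :=
  derivationOfDual (fractionDual K D) (fractionDual_fst K D)

@[simp] theorem fractionDerivation_algebraMap {R : Type*} [CommRing R] (K : Type*) [CommRing K]
    [Algebra R K] [IsFractionRing R K] (D : Derivation ℤ R R) (r : R) :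
    fractionDerivation K D (algebraMap R K r) = algebraMap R K (D r) := by
  simp [fractionDerivation, fractionDual_algebraMap]

/-! ### Differential polynomials -/

/-- Differential polynomials over `F` in the differential indeterminates `y s`, `s : σ`, for `m`
commuting derivations: polynomials in independent variables `(s, α)`, where `(s, α)`
stands for the derivative `∂₁^{α₁} ⋯ ∂ₘ^{αₘ} (y s)`. -/
abbrev DiffPoly (F : Type*) [Field F] (m : ℕ) (σ : Type*) : Type _ :=
  MvPolynomial (σ × (Fin m →₀ ℕ)) F

variable {F : Type*} [Field F] {m : ℕ} {σ : Type*}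

/-- The homomorphism `p ↦ p + (∂ₖ p) ε` on differential polynomials. -/
def DiffPoly.dual (σ : Type*) (d : Fin m → Derivation ℤ F F) (k : Fin m) :
    DiffPoly F m σ →+* DualNumber (DiffPoly F m σ) :=
  MvPolynomial.eval₂Hom (dualOfDerivation MvPolynomial.C (d k))
    (fun v => TrivSqZeroExt.inl (MvPolynomial.X v) +
      TrivSqZeroExt.inr (MvPolynomial.X (v.1, v.2 + Finsupp.single k 1)))

theorem DiffPoly.dual_fst (σ : Type*) (d : Fin m → Derivation ℤ F F) (k : Fin m)
    (p : DiffPoly F m σ) : (DiffPoly.dual σ d k p).fst = p := by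
  have key : (TrivSqZeroExt.fstHom (DiffPoly F m σ) (DiffPoly F m σ)
      (DiffPoly F m σ)).toRingHom.comp (DiffPoly.dual σ d k) = RingHom.id _ := by
    apply MvPolynomial.ringHom_ext
    · intro r
      simp [DiffPoly.dual]
    · intro v
      simp [DiffPoly.dual]
  exact congrArg (fun φ : DiffPoly F m σ →+* DiffPoly F m σ => φ p) key

/-- The derivation `∂ₖ` on differential polynomials: it extends `∂ₖ` from the coefficient
field and maps the variable `(s, α)` to `(s, α + eₖ)`. -/
def DiffPoly.D (σ : Type*) (d : Fin m → Derivation ℤ F F) (k : Fin m) :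
    Derivation ℤ (DiffPoly F m σ) (DiffPoly F m σ) :=
  derivationOfDual (DiffPoly.dual σ d k) (DiffPoly.dual_fst σ d k)

@[simp] theorem DiffPoly.D_C (d : Fin m → Derivation ℤ F F) (k : Fin m) (a : F) :
    DiffPoly.D σ d k (MvPolynomial.C a) = MvPolynomial.C (d k a) := by
  refine (derivationOfDual_apply (DiffPoly.dual σ d k) (DiffPoly.dual_fst σ d k) _).trans ?_
  simp [DiffPoly.dual]

@[simp] theorem DiffPoly.D_X (d : Fin m → Derivation ℤ F F) (k : Fin m)
    (v : σ × (Fin m →₀ ℕ)) :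
    DiffPoly.D σ d k (MvPolynomial.X v) =
      MvPolynomial.X (v.1, v.2 + Finsupp.single k 1) := by
  refine (derivationOfDual_apply (DiffPoly.dual σ d k) (DiffPoly.dual_fst σ d k) _).trans ?_
  simp [DiffPoly.dual]

/-- The operator `δ₁^{α₁} ∘ ⋯ ∘ δₘ^{αₘ}` (it is used for commuting `δᵢ`, where the order of the
factors does not matter). -/
def iterD {K : Type*} [CommRing K] (δ : Fin m → Derivation ℤ K K) (α : Fin m →₀ ℕ) :
    Module.End ℤ K :=
  (List.ofFn fun i => (δ i : K →ₗ[ℤ] K) ^ α i).prod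

/-- The value `p^δ{y}`: in the differential polynomial `p`, the symbols `∂ᵢ` are replaced
by the derivations `δᵢ` of `K` and the indeterminates by the elements `y s` of `K`;
the coefficients of `p` are kept. -/
def DiffPoly.eval {K : Type*} [CommRing K] [Algebra F K] (δ : Fin m → Derivation ℤ K K)
    (y : σ → K) (p : DiffPoly F m σ) : K :=
  MvPolynomial.aeval (fun v => iterD δ v.2 (y v.1)) p

/-- The system of derivations `g⁻¹ d`, where `d` is regarded as a column vector. -/
def gaugeD {K : Type*} [Field K] (g : Matrix (Fin m) (Fin m) K)
    (d : Fin m → Derivation ℤ K K) (i : Fin m) : Derivation ℤ K K :=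
  ∑ j, (g⁻¹ i j) • d j

/-! ### The generic matrix `T` with `∂ₖ tᵢⱼ = ∂ᵢ tₖⱼ`

Indeterminates are indexed by `(Fin m × Fin m) ⊕ Fin l`: the entries `tᵢⱼ` of `T`, and
further independent differential indeterminates `t_{m+1}, …, t_{m+l}`. -/

/-- All derivatives `∂^β (∂ₖ tᵢⱼ - ∂ᵢ tₖⱼ)` of the basic relations. -/
def relations (F : Type*) [Field F] (m l : ℕ) :
    Set (DiffPoly F m ((Fin m × Fin m) ⊕ Fin l)) :=
  {r | ∃ (i j k : Fin m) (β : Fin m →₀ ℕ),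
    r = MvPolynomial.X (Sum.inl (i, j), β + Finsupp.single k 1) -
      MvPolynomial.X (Sum.inl (k, j), β + Finsupp.single i 1)}

/-- The differential ideal generated by the basic relations. -/
def relIdeal (F : Type*) [Field F] (m l : ℕ) :
    Ideal (DiffPoly F m ((Fin m × Fin m) ⊕ Fin l)) :=
  Ideal.span (relations F m l)

theorem D_mem_relIdeal {l : ℕ} (d : Fin m → Derivation ℤ F F) (k : Fin m) :
    ∀ r ∈ relIdeal F m l, DiffPoly.D _ d k r ∈ relIdeal F m l := by
  intro r hr
  refine Submodule.span_induction (p := fun r _ => DiffPoly.D _ d k r ∈ relIdeal F m l)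
    ?_ ?_ ?_ ?_ hr
  · rintro _ ⟨i, j, k', β, rfl⟩
    refine Ideal.subset_span ⟨i, j, k', β + Finsupp.single k 1, ?_⟩
    simp [add_right_comm]
  · simp
  · intro x y _ _ hx hy
    rw [map_add]
    exact add_mem hx hy
  · intro a x hx hDx
    rw [smul_eq_mul, Derivation.leibniz]
    refine add_mem (Ideal.mul_mem_left _ _ hDx) ?_
    rw [smul_eq_mul, mul_comm]
    exact Ideal.mul_mem_left _ _ hx

/-- The differential ring `F{T, t_{m+1}, …, t_{m+l}}`. -/
def GenericRing (F : Type*) [Field F] (m l : ℕ) : Type _ :=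
  DiffPoly F m ((Fin m × Fin m) ⊕ Fin l) ⧸ relIdeal F m l

instance (F : Type*) [Field F] (m l : ℕ) : CommRing (GenericRing F m l) :=
  inferInstanceAs (CommRing (DiffPoly F m ((Fin m × Fin m) ⊕ Fin l) ⧸ relIdeal F m l))

instance (F : Type*) [Field F] (m l : ℕ) : Algebra F (GenericRing F m l) :=
  inferInstanceAs (Algebra F (DiffPoly F m ((Fin m × Fin m) ⊕ Fin l) ⧸ relIdeal F m l))

/-- The quotient map from differential polynomials to the generic ring. -/
def toGeneric (F : Type*) [Field F] (m l : ℕ) :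
    DiffPoly F m ((Fin m × Fin m) ⊕ Fin l) →ₐ[F] GenericRing F m l :=
  Ideal.Quotient.mkₐ F (relIdeal F m l)

theorem toGeneric_surjective (F : Type*) [Field F] (m l : ℕ) :
    Function.Surjective (toGeneric F m l) :=
  Ideal.Quotient.mk_surjective

theorem toGeneric_eq_zero_iff {l : ℕ} (r : DiffPoly F m ((Fin m × Fin m) ⊕ Fin l)) :
    toGeneric F m l r = 0 ↔ r ∈ relIdeal F m l :=
  Ideal.Quotient.eq_zero_iff_mem

theorem toGeneric_eq_iff {l : ℕ} (r s : DiffPoly F m ((Fin m × Fin m) ⊕ Fin l)) :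
    toGeneric F m l r = toGeneric F m l s ↔ r - s ∈ relIdeal F m l :=
  Ideal.Quotient.eq

/-- Auxiliary map used to see that the generic ring is a domain: `tᵢⱼ ↦ ∂ᵢ sⱼ` with
independent differential indeterminates `s₁, …, sₘ, t_{m+1}, …, t_{m+l}`. -/
def potential (F : Type*) [Field F] (m l : ℕ) :
    DiffPoly F m ((Fin m × Fin m) ⊕ Fin l) →ₐ[F] DiffPoly F m (Fin m ⊕ Fin l) :=
  MvPolynomial.aeval (fun v => match v with
    | (Sum.inl (i, j), β) => MvPolynomial.X (Sum.inl j, β + Finsupp.single i 1)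
    | (Sum.inr q, β) => MvPolynomial.X (Sum.inr q, β))

theorem ker_potential (F : Type*) [Field F] (m l : ℕ) :
    RingHom.ker (potential F m l) = relIdeal F m l := by
  classical
  apply le_antisymm
  · -- a partial inverse of `potential`, modulo the relations
    let ψ : DiffPoly F m (Fin m ⊕ Fin l) →ₐ[F] GenericRing F m l :=
      MvPolynomial.aeval (fun v => match v with
        | (Sum.inl j, α) => if h : ∃ i, α i ≠ 0 then
            toGeneric F m l (MvPolynomial.X
              (Sum.inl (h.choose, j), α - Finsupp.single h.choose 1)) else 0
        | (Sum.inr q, β) => toGeneric F m l (MvPolynomial.X (Sum.inr q, β)))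
    have hψ : ψ.comp (potential F m l) = toGeneric F m l := by
      apply MvPolynomial.algHom_ext
      rintro ⟨⟨i, j⟩ | q, β⟩
      · have h : ∃ i', (β + Finsupp.single i 1 : Fin m →₀ ℕ) i' ≠ 0 := ⟨i, by simp⟩
        have h1 : ψ (potential F m l (MvPolynomial.X (Sum.inl (i, j), β))) =
            toGeneric F m l (MvPolynomial.X (Sum.inl (h.choose, j),
              β + Finsupp.single i 1 - Finsupp.single h.choose 1)) := by
          simp only [potential, ψ, MvPolynomial.aeval_X]
          rw [dif_pos h]
        rw [AlgHom.comp_apply, h1]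
        have h2 := h.choose_spec
        generalize h.choose = i' at h2
        by_cases hi : i' = i
        · subst hi
          simp
        · have hb : β i' ≠ 0 := by
            simpa [Finsupp.single_apply, Ne.symm hi] using h2
          obtain ⟨γ, rfl⟩ : ∃ γ, β = γ + Finsupp.single i' 1 :=
            ⟨β - Finsupp.single i' 1, by
              rw [tsub_add_cancel_of_le]
              rw [Finsupp.single_le_iff]
              omega⟩
          have h3 : γ + Finsupp.single i' 1 + Finsupp.single i 1 - Finsupp.single i' 1 =
              γ + Finsupp.single i 1 := by
            rw [add_right_comm, add_tsub_cancel_right]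
          rw [h3, toGeneric_eq_iff]
          exact Ideal.subset_span ⟨i', j, i, γ, rfl⟩
      · simp [potential, ψ]
    intro p hp
    rw [RingHom.mem_ker] at hp
    have := congrArg (fun φ => φ p) hψ
    simp only [AlgHom.comp_apply] at this
    rw [← toGeneric_eq_zero_iff, ← this]
    exact (congrArg ψ hp).trans (map_zero ψ)
  · refine Ideal.span_le.2 ?_
    rintro _ ⟨i, j, k, β, rfl⟩
    simp [potential, RingHom.mem_ker, add_right_comm]

instance genericRing_isDomain (F : Type*) [Field F] (m l : ℕ) : IsDomain (GenericRing F m l) := by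
  refine (Ideal.Quotient.isDomain_iff_prime (relIdeal F m l)).2 ?_
  rw [← ker_potential]
  exact RingHom.ker_isPrime _

/-- The differential field `F⟨T, t_{m+1}, …, t_{m+l}⟩`. -/
def GenericField (F : Type*) [Field F] (m l : ℕ) : Type _ :=
  FractionRing (GenericRing F m l)

instance (F : Type*) [Field F] (m l : ℕ) : Field (GenericField F m l) :=
  inferInstanceAs (Field (FractionRing (GenericRing F m l)))

instance (F : Type*) [Field F] (m l : ℕ) : Algebra (GenericRing F m l) (GenericField F m l) :=
  inferInstanceAs (Algebra (GenericRing F m l) (FractionRing (GenericRing F m l)))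

instance (F : Type*) [Field F] (m l : ℕ) :
    IsFractionRing (GenericRing F m l) (GenericField F m l) :=
  inferInstanceAs (IsFractionRing (GenericRing F m l) (FractionRing (GenericRing F m l)))

instance (F : Type*) [Field F] (m l : ℕ) : Algebra F (GenericField F m l) :=
  ((algebraMap (GenericRing F m l) (GenericField F m l)).comp
    (algebraMap F (GenericRing F m l))).toAlgebra

instance (F : Type*) [Field F] (m l : ℕ) :
    IsScalarTower F (GenericRing F m l) (GenericField F m l) :=
  IsScalarTower.of_algebraMap_eq fun _ => rfl

/-- The derivations of the generic differential field. -/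
def genericD (l : ℕ) (d : Fin m → Derivation ℤ F F) (k : Fin m) :
    Derivation ℤ (GenericField F m l) (GenericField F m l) :=
  fractionDerivation (GenericField F m l)
    (quotientDerivation (toGeneric F m l).toRingHom (toGeneric_surjective F m l)
      (DiffPoly.D _ d k) (fun r hr => (toGeneric_eq_zero_iff _).2
        (D_mem_relIdeal d k r ((toGeneric_eq_zero_iff r).1 hr))))

theorem genericD_apply {l : ℕ} (d : Fin m → Derivation ℤ F F) (k : Fin m)
    (r : DiffPoly F m ((Fin m × Fin m) ⊕ Fin l)) :
    genericD l d k (algebraMap (GenericRing F m l) (GenericField F m l) (toGeneric F m l r)) =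
      algebraMap (GenericRing F m l) (GenericField F m l)
        (toGeneric F m l (DiffPoly.D _ d k r)) := by
  rw [genericD, fractionDerivation_algebraMap]
  exact congrArg _ (quotientDerivation_apply (toGeneric F m l).toRingHom _ _ _ r)

/-- The derivations of the generic differential field extend those of `F`. -/
theorem genericD_algebraMap {l : ℕ} (d : Fin m → Derivation ℤ F F) (k : Fin m) (a : F) :
    genericD l d k (algebraMap F (GenericField F m l) a) =
      algebraMap F (GenericField F m l) (d k a) := by
  have h (b : F) : algebraMap F (GenericField F m l) b =
      algebraMap (GenericRing F m l) (GenericField F m l)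
        (toGeneric F m l (MvPolynomial.C b)) := rfl
  rw [h, h, genericD_apply, DiffPoly.D_C]

/-- The differential indeterminates, as elements of the generic differential field. -/
def genericVar (F : Type*) [Field F] (m l : ℕ) (s : (Fin m × Fin m) ⊕ Fin l) :
    GenericField F m l :=
  algebraMap (GenericRing F m l) (GenericField F m l)
    (toGeneric F m l (MvPolynomial.X (s, 0)))

/-- The generic matrix `T = (tᵢⱼ)`. -/
def genericT (F : Type*) [Field F] (m l : ℕ) : Matrix (Fin m) (Fin m) (GenericField F m l) :=
  Matrix.of fun i j => genericVar F m l (Sum.inl (i, j))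

/-- The remaining indeterminates `t_{m+1}, …, t_{m+l}`. -/
def generict (F : Type*) [Field F] (m l : ℕ) (q : Fin l) : GenericField F m l :=
  genericVar F m l (Sum.inr q)

/-- `T` satisfies the basic relations. -/
theorem genericD_genericT {l : ℕ} (d : Fin m → Derivation ℤ F F) (i j k : Fin m) :
    genericD l d k (genericT F m l i j) = genericD l d i (genericT F m l k j) := by
  simp only [genericT, genericVar, Matrix.of_apply, genericD_apply, DiffPoly.D_X]
  congr 1
  rw [toGeneric_eq_iff]
  exact Ideal.subset_span ⟨i, j, k, 0, rfl⟩

/-- `T` is nonsingular, so that `T⁻¹` is a genuine inverse. -/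
theorem genericT_det_ne_zero (F : Type*) [Field F] (m l : ℕ) : (genericT F m l).det ≠ 0 := by
  have hT : genericT F m l =
      ((Matrix.of fun i j : Fin m => (MvPolynomial.X (Sum.inl (i, j), 0) :
        DiffPoly F m ((Fin m × Fin m) ⊕ Fin l))).map (toGeneric F m l)).map
        (algebraMap (GenericRing F m l) (GenericField F m l)) := rfl
  rw [hT, ← RingHom.mapMatrix_apply, ← RingHom.map_det, ← AlgHom.mapMatrix_apply,
    ← AlgHom.map_det]
  rw [Ne, FaithfulSMul.algebraMap_eq_zero_iff, toGeneric_eq_zero_iff, ← ker_potential,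
    RingHom.mem_ker]
  intro h
  -- specialise `T` to the identity matrix
  have h' := congrArg (MvPolynomial.aeval (fun v : (Fin m ⊕ Fin l) × (Fin m →₀ ℕ) =>
    match v with
    | (Sum.inl j, α) => if α = Finsupp.single j 1 then (1 : F) else 0
    | (Sum.inr _, _) => 0)) h
  rw [map_zero, AlgHom.map_det, AlgHom.map_det] at h'
  refine one_ne_zero (α := F) ?_
  rw [← h', ← Matrix.det_one (n := Fin m)]
  congr 1
  ext i j
  simp [potential, Matrix.one_apply, Finsupp.single_left_inj]

end DiffAlg

end

/-! The relations say that the columns of `T` are gradients: `t_ij = ∂_i s_j` for independent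
potentials `s_j`. The derivatives of positive order of the `s_j`, together with all derivatives of
the remaining `t_{m+q}`, are therefore algebraically independent over `F`; call this family `x`. The
derivatives of `𝐞T` and of the `t_{m+q}` form a subfamily of `x`, which gives a).

For b) and c), put `δ = T⁻¹∂`. In each case a second family `z`, on the same index set, is built to
contain the relevant `δ`-derivatives. Weigh an index by the order of the derivative of `t_ij` or
`t_{m+q}` that it stands for. Only finitely many indices have weight at most `n`, so `z` is
algebraically independent as soon as each `x v` is a rational function of members of `z` of no
greater weight: compare transcendence degrees in each layer
(`algebraicIndependent_of_mem_adjoin_of_weight`).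

Rationality with this control of order comes from `∂ = Tδ`. A `∂`-derivative of order `n` of a
rational function of the `y s` involves only `δ`-derivatives of the `y s` of order at most `n` and
`∂`-derivatives of `T` of order less than `n` (`iterD_mem_of_gaugeD`). Induction on `n` then
eliminates the derivatives of `T` (`algebraicIndependent_of_gaugeD_mem`).

For b), `T⁻¹` satisfies the basic relations for `δ` (`gaugeD_inv_apply`), so it has `δ`-potentials,
and their jets serve as `z`. For c), `z` is obtained from `x` by replacing `∂` with `δ` in the
derivatives of the first row and of the `t_{m+q}`, all other members being kept. -/

namespace DiffAlg

/-! ### Algebraic independence by counting transcendence degree -/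

section Transcendence

variable {F K ι : Type*} [Field F] [Field K] [Algebra F K]

/-- A finite family that generates a field containing an algebraically independent family with
the same index set is itself algebraically independent. -/
theorem algebraicIndependent_of_mem_adjoin [Finite ι] {x z : ι → K}
    (hx : AlgebraicIndependent F x)
    (h : ∀ i, x i ∈ IntermediateField.adjoin F (Set.range z)) : AlgebraicIndependent F z := by
  let E := IntermediateField.adjoin F (Set.range z)
  let z' : ι → E := fun i => ⟨z i, IntermediateField.subset_adjoin _ _ ⟨i, rfl⟩⟩
  let x' : ι → E := fun i => ⟨x i, h i⟩
  have hx' : AlgebraicIndependent F x' := AlgebraicIndependent.of_comp E.val hx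
  have htop : IntermediateField.adjoin F (Set.range z') = ⊤ := by
    apply IntermediateField.map_injective E.val
    rw [IntermediateField.adjoin_map, ← Set.range_comp, ← AlgHom.fieldRange_eq_map,
      IntermediateField.fieldRange_val]
    rfl
  have hfrac : IsFractionRing (Algebra.adjoin F (Set.range z')) E := by
    have := IsFractionRing.of_field (Algebra.adjoin F (Set.range z')) E (fun a => by
      have ha : a ∈ IntermediateField.adjoin F (Set.range z') := htop ▸ IntermediateField.mem_top
      obtain ⟨r, hr, s, hs, e⟩ := IntermediateField.mem_adjoin_iff_div.1 ha
      exact ⟨⟨r, hr⟩, ⟨s, hs⟩, e⟩)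
    exact this
  have halg : Algebra.IsAlgebraic (Algebra.adjoin F (Set.range z')) E :=
    IsLocalization.isAlgebraic _ (nonZeroDivisors (Algebra.adjoin F (Set.range z')))
  -- `E` is algebraic over `F[z']` and contains the independent family `x'` of the same finite size,
  -- so the generating family `z'` has no room for a relation.
  have hz' : AlgebraicIndependent F z' :=
    (Algebra.IsAlgebraic.isTranscendenceBasis_of_lift_le_trdeg_of_finite F z' hx'.lift_cardinalMk_le_trdeg).1
  exact hz'.map' (f := E.val) E.val.injective

/-- Let `x` be an algebraically independent family with a weight on its index set such that there
are finitely many indices of bounded weight. A family `z` such that every `x i` is a rational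
function of the `z j` of at most the same weight is algebraically independent. -/
theorem algebraicIndependent_of_mem_adjoin_of_weight {x z : ι → K}
    (hx : AlgebraicIndependent F x) (wt : ι → ℕ) (hfin : ∀ n, {i | wt i ≤ n}.Finite)
    (h : ∀ i, x i ∈ IntermediateField.adjoin F (z '' {j | wt j ≤ wt i})) :
    AlgebraicIndependent F z := by
  apply algebraicIndependent_of_finite_type
  intro t ht
  -- A finite set of indices lies in a layer of bounded weight. That layer is finite and closed
  -- under the dependence in `h`, so the finite case applies to it.
  obtain ⟨n, hn⟩ := (ht.image wt).bddAbove
  have : Finite {i | wt i ≤ n} := hfin n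
  have key : AlgebraicIndependent F (fun i : {i | wt i ≤ n} => z i) := by
    apply algebraicIndependent_of_mem_adjoin (x := fun i : {i | wt i ≤ n} => x i)
      (hx.comp _ Subtype.val_injective)
    rintro ⟨i, hi⟩
    refine IntermediateField.adjoin.mono F _ _ ?_ (h i)
    rintro _ ⟨j, hj, rfl⟩
    exact ⟨⟨j, show wt j ≤ n from le_trans hj hi⟩, rfl⟩
  exact key.comp (fun i : t => (⟨i, hn ⟨i, i.2, rfl⟩⟩ : {i | wt i ≤ n}))
    (fun a b hab => Subtype.ext (congrArg (fun c : {i | wt i ≤ n} => (c : ι)) hab))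

theorem derivation_mem_of_mem_adjoin (D : Derivation ℤ K K) {S : Set K}
    {L : IntermediateField F K} (hF : ∀ a : F, D (algebraMap F K a) ∈ L) (hS : ∀ a ∈ S, a ∈ L)
    (hD : ∀ a ∈ S, D a ∈ L) {a : K} (ha : a ∈ IntermediateField.adjoin F S) : D a ∈ L := by
  have hle : IntermediateField.adjoin F S ≤ L := IntermediateField.adjoin_le_iff.2 hS
  induction ha using IntermediateField.adjoin_induction with
  | mem a ha => exact hD a ha
  | algebraMap a => exact hF a
  | add a b _ _ ha hb => rw [map_add]; exact add_mem ha hb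
  | inv a hs ha =>
    rw [Derivation.leibniz_inv, smul_eq_mul]
    exact mul_mem (neg_mem (pow_mem (inv_mem (hle hs)) 2)) ha
  | mul a b hs ht ha hb =>
    rw [Derivation.leibniz, smul_eq_mul, smul_eq_mul]
    exact add_mem (mul_mem (hle hs) hb) (mul_mem (hle ht) ha)

end Transcendence

/-! ### Multi-indices and discrete potentials -/

section Exponents

variable {m : ℕ}

theorem exponent_eq_zero_or (α : Fin m →₀ ℕ) :
    α = 0 ∨ ∃ β i, α = β + Finsupp.single i 1 := by
  by_cases h : α = 0
  · exact Or.inl h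
  · obtain ⟨i, hi⟩ := Finsupp.ne_iff.1 h
    refine Or.inr ⟨α - Finsupp.single i 1, i, ?_⟩
    rw [tsub_add_cancel_of_le]
    rw [Finsupp.single_le_iff]
    exact Nat.one_le_iff_ne_zero.2 hi

theorem exponent_induction {P : (Fin m →₀ ℕ) → Prop} (zero : P 0)
    (add : ∀ α i, P α → P (α + Finsupp.single i 1)) (α : Fin m →₀ ℕ) : P α := by
  induction hn : α.degree using Nat.strong_induction_on generalizing α with
  | _ n ih =>
    rcases exponent_eq_zero_or α with rfl | ⟨β, i, rfl⟩
    · exact zero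
    · refine add _ _ (ih β.degree ?_ β rfl)
      rw [map_add, Finsupp.degree_single] at hn
      omega

/-- A family of functions satisfying the integrability conditions has a common potential. -/
theorem exists_potential {A : Type*} [Inhabited A] (h : Fin m → (Fin m →₀ ℕ) → A)
    (hh : ∀ i k β, h i (β + Finsupp.single k 1) = h k (β + Finsupp.single i 1)) :
    ∃ H : (Fin m →₀ ℕ) → A, ∀ i β, H (β + Finsupp.single i 1) = h i β := by
  classical
  -- The integrability condition makes the value independent of the chosen direction. The value at
  -- `0` is unconstrained, hence the default.
  refine ⟨fun α => if hα : ∃ i, α i ≠ 0 then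
    h hα.choose (α - Finsupp.single hα.choose 1) else default, fun i β => ?_⟩
  have hα : ∃ k, (β + Finsupp.single i 1 : Fin m →₀ ℕ) k ≠ 0 := ⟨i, by simp⟩
  simp only [dif_pos hα]
  have h2 := hα.choose_spec
  generalize hα.choose = k at h2
  by_cases hi : k = i
  · subst hi
    simp
  · have hb : β k ≠ 0 := by simpa [Finsupp.single_apply, Ne.symm hi] using h2
    obtain ⟨γ, rfl⟩ : ∃ γ, β = γ + Finsupp.single k 1 :=
      ⟨β - Finsupp.single k 1, by
        rw [tsub_add_cancel_of_le]
        rw [Finsupp.single_le_iff]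
        omega⟩
    rw [add_right_comm, add_tsub_cancel_right, hh]

end Exponents

/-! ### Iterated commuting derivations -/

section IteratedDerivations

variable {m : ℕ}

/-- `iterD` is a product in a fixed order; raising one exponent inserts a factor in the middle,
which has to be moved to the front. -/
theorem list_prod_ofFn_mul_single {M : Type*} [Monoid M] {n : ℕ} (f g : Fin n → M) (c : M)
    (k : Fin n) (hc : ∀ i, Commute c (f i)) (hk : g k = c * f k) (hg : ∀ i, i ≠ k → g i = f i) :
    (List.ofFn g).prod = c * (List.ofFn f).prod := by
  induction n with
  | zero => exact k.elim0
  | succ n ih =>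
    rw [List.ofFn_succ, List.ofFn_succ, List.prod_cons, List.prod_cons]
    induction k using Fin.cases with
    | zero =>
      have : (fun i : Fin n => g i.succ) = fun i => f i.succ :=
        funext fun i => hg _ (Fin.succ_ne_zero i)
      rw [hk, this, mul_assoc]
    | succ k =>
      rw [hg 0 (Fin.succ_ne_zero k).symm, ih (fun i => f i.succ) (fun i => g i.succ) k
        (fun i => hc _) hk (fun i hi => hg _ (fun e => hi (Fin.succ_injective _ e))),
        ← mul_assoc, ← (hc 0).eq, mul_assoc]

variable {K : Type*} [CommRing K]

@[simp] theorem iterD_zero (δ : Fin m → Derivation ℤ K K) (a : K) : iterD δ 0 a = a := by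
  simp [iterD]

theorem iterD_add_single {δ : Fin m → Derivation ℤ K K} (hδ : ∀ i j a, δ i (δ j a) = δ j (δ i a))
    (α : Fin m →₀ ℕ) (k : Fin m) (a : K) :
    iterD δ (α + Finsupp.single k 1) a = δ k (iterD δ α a) := by
  have hcomm : ∀ i j, Commute (δ i : K →ₗ[ℤ] K) (δ j : K →ₗ[ℤ] K) := fun i j =>
    LinearMap.ext fun a => hδ i j a
  have := list_prod_ofFn_mul_single (fun i => (δ i : K →ₗ[ℤ] K) ^ α i)
    (fun i => (δ i : K →ₗ[ℤ] K) ^ (α + Finsupp.single k 1 : Fin m →₀ ℕ) i) (δ k : K →ₗ[ℤ] K) k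
    (fun i => (hcomm k i).pow_right _)
    (by simp [pow_succ']) (fun i hi => by simp [hi.symm])
  rw [iterD, this]
  rfl

theorem iterD_integrability {δ : Fin m → Derivation ℤ K K}
    (hδ : ∀ i j a, δ i (δ j a) = δ j (δ i a)) {a b : K} {i k : Fin m} (h : δ k a = δ i b)
    (β : Fin m →₀ ℕ) :
    iterD δ (β + Finsupp.single k 1) a = iterD δ (β + Finsupp.single i 1) b := by
  induction β using exponent_induction with
  | zero =>
    rw [iterD_add_single hδ, iterD_add_single hδ]
    simpa using h
  | add β j ih =>
    rw [add_right_comm, iterD_add_single hδ, ih, add_right_comm β, iterD_add_single hδ _ j]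

end IteratedDerivations

/-! ### The derivations `T⁻¹∂` -/

section Gauge

variable {m : ℕ} {K : Type*} [Field K] (T : Matrix (Fin m) (Fin m) K)
  (d : Fin m → Derivation ℤ K K)

theorem gaugeD_apply (i : Fin m) (a : K) : gaugeD T d i a = ∑ j, T⁻¹ i j * d j a := by
  rw [gaugeD, ← Derivation.coeFnAddMonoidHom_apply, map_sum, Finset.sum_apply]
  rfl

variable {T d}

theorem sum_mul_gaugeD (hT : T.det ≠ 0) (k : Fin m) (a : K) :
    d k a = ∑ i, T k i * gaugeD T d i a := by
  have h : T * T⁻¹ = 1 := Matrix.mul_nonsing_inv T (isUnit_iff_ne_zero.2 hT)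
  have h1 : (fun i => gaugeD T d i a) = T⁻¹ *ᵥ (fun j => d j a) := by
    ext i
    rw [gaugeD_apply]
    rfl
  have h2 : T *ᵥ (fun i => gaugeD T d i a) = fun j => d j a := by
    rw [h1, Matrix.mulVec_mulVec, h, Matrix.one_mulVec]
  exact (congrFun h2 k).symm

theorem derivation_inv_apply (hT : T.det ≠ 0) (D : Derivation ℤ K K) (k b : Fin m) :
    D (T⁻¹ k b) = -∑ c, ∑ e, T⁻¹ k c * D (T c e) * T⁻¹ e b := by
  have hu := isUnit_iff_ne_zero.2 hT
  -- This is the Leibniz rule applied to `T⁻¹ T = 1`.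
  have h1 : (T⁻¹).map D * T = -(T⁻¹ * T.map D) := by
    ext i j
    have h := congrArg D (congrFun (congrFun (Matrix.nonsing_inv_mul T hu) i) j)
    have h0 : D ((1 : Matrix (Fin m) (Fin m) K) i j) = 0 := by
      rw [Matrix.one_apply]
      split_ifs <;> simp
    rw [h0, Matrix.mul_apply, map_sum] at h
    simp only [Derivation.leibniz, smul_eq_mul, Finset.sum_add_distrib] at h
    simp only [Matrix.neg_apply, Matrix.mul_apply, Matrix.map_apply]
    rw [eq_neg_iff_add_eq_zero, add_comm, ← h]
    congr 1
    exact Finset.sum_congr rfl fun _ _ => mul_comm _ _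
  have h2 : (T⁻¹).map D = -(T⁻¹ * T.map D) * T⁻¹ := by
    rw [← h1, Matrix.mul_assoc, Matrix.mul_nonsing_inv T hu, Matrix.mul_one]
  have h3 := congrFun (congrFun h2 k) b
  rw [Matrix.map_apply] at h3
  rw [h3, Matrix.neg_mul, Matrix.neg_apply, Matrix.mul_apply, Finset.sum_comm]
  simp only [Matrix.mul_apply, Finset.sum_mul, Matrix.map_apply]

/-- The inverse of `T` satisfies the basic relations with respect to the derivations `T⁻¹ d`. -/
theorem gaugeD_inv_apply (hT : T.det ≠ 0) (hd : ∀ i j k, d k (T i j) = d i (T k j))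
    (i k b : Fin m) : gaugeD T d i (T⁻¹ k b) = gaugeD T d k (T⁻¹ i b) := by
  rw [gaugeD_apply, gaugeD_apply]
  simp only [derivation_inv_apply hT, mul_neg, Finset.mul_sum, Finset.sum_neg_distrib]
  rw [Finset.sum_comm]
  -- Both sides are quadratic in rows `i` and `k` of `T⁻¹`, contracted with the derivatives of `T`.
  -- Exchanging the two contracted indices is exactly the basic relation.
  refine congrArg _ (Finset.sum_congr rfl fun f _ => Finset.sum_congr rfl fun c _ =>
    Finset.sum_congr rfl fun e _ => ?_)
  rw [hd]
  ring

/-- Expanding by the Leibniz rule, the second-order terms are symmetric because the `d i` commute,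
and the first-order terms by `gaugeD_inv_apply`. -/
theorem gaugeD_comm (hT : T.det ≠ 0) (hd : ∀ i j k, d k (T i j) = d i (T k j))
    (hcomm : ∀ i j a, d i (d j a) = d j (d i a)) (i k : Fin m) (a : K) :
    gaugeD T d i (gaugeD T d k a) = gaugeD T d k (gaugeD T d i a) := by
  have key : ∀ i k, gaugeD T d i (gaugeD T d k a) =
      ∑ b, ∑ c, T⁻¹ k b * (T⁻¹ i c * d c (d b a)) + ∑ b, d b a * gaugeD T d i (T⁻¹ k b) := by
    intro i k
    rw [gaugeD_apply T d k, map_sum]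
    simp only [Derivation.leibniz, smul_eq_mul, Finset.sum_add_distrib]
    congr 1
    refine Finset.sum_congr rfl fun b _ => ?_
    rw [gaugeD_apply, Finset.mul_sum]
  rw [key, key, Finset.sum_comm]
  congr 1
  · refine Finset.sum_congr rfl fun b _ => Finset.sum_congr rfl fun c _ => ?_
    rw [hcomm]
    ring
  · refine Finset.sum_congr rfl fun b _ => ?_
    rw [gaugeD_inv_apply hT hd]

end Gauge

/-! ### Comparing orders with respect to `∂` and `T⁻¹∂` -/

section Filtration

variable {F K : Type*} [Field F] [Field K] [Algebra F K] {m : ℕ}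
  {T : Matrix (Fin m) (Fin m) K} {d : Fin m → Derivation ℤ K K} {σ : Type*}

/-- If a field `M` contains the derivatives of `T` of order less than `n` and the derivatives of
the elements `y s` with respect to `T⁻¹ d` of order at most `n`, then it contains the derivatives
with respect to `d` of order at most `n` of the elements of `F(y)`. -/
theorem iterD_mem_of_gaugeD (hF : ∀ k (a : F), ∃ b : F, d k (algebraMap F K a) = algebraMap F K b)
    (hT : T.det ≠ 0) (hcomm : ∀ i j a, d i (d j a) = d j (d i a))
    (hcomm' : ∀ i j a, gaugeD T d i (gaugeD T d j a) = gaugeD T d j (gaugeD T d i a))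
    (y : σ → K) (M : IntermediateField F K) (n : ℕ)
    (hMT : ∀ i j β, β.degree < n → iterD d β (T i j) ∈ M)
    (hMy : ∀ s α, α.degree ≤ n → iterD (gaugeD T d) α (y s) ∈ M)
    {a : K} (ha : a ∈ IntermediateField.adjoin F (Set.range y)) (β : Fin m →₀ ℕ)
    (hβ : β.degree ≤ n) : iterD d β a ∈ M := by
  -- The strict inequality for `T` against the weak one for `y` is what later permits induction on
  -- the order: only lower derivatives of `T` occur.
  let S : ℕ → Set K := fun n => {b | ∃ i j β, β.degree < n ∧ iterD d β (T i j) = b} ∪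
    {b | ∃ s α, α.degree ≤ n ∧ iterD (gaugeD T d) α (y s) = b}
  let N : ℕ → IntermediateField F K := fun n => IntermediateField.adjoin F (S n)
  have hSN : ∀ n b, b ∈ S n → b ∈ N n := fun n b hb => IntermediateField.subset_adjoin F _ hb
  have hSmono : ∀ p q, p ≤ q → S p ⊆ S q := by
    rintro p q hpq b (⟨i, j, β, h, rfl⟩ | ⟨s, α, h, rfl⟩)
    · exact Or.inl ⟨i, j, β, h.trans_le hpq, rfl⟩
    · exact Or.inr ⟨s, α, h.trans hpq, rfl⟩
  have hstep : ∀ n k b, b ∈ N n → d k b ∈ N (n + 1) := by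
    intro n k b hb
    refine derivation_mem_of_mem_adjoin (d k) (fun a => ?_) (fun b hb => ?_) (fun b hb => ?_) hb
    · obtain ⟨c, hc⟩ := hF k a
      rw [hc]
      exact (N (n + 1)).algebraMap_mem c
    · exact hSN _ _ (hSmono n (n + 1) n.le_succ hb)
    · rcases hb with ⟨i, j, β, h, rfl⟩ | ⟨s, α, h, rfl⟩
      · rw [← iterD_add_single hcomm]
        exact hSN _ _ (Or.inl ⟨i, j, _, by simpa using h, rfl⟩)
      -- Since `d k = ∑ T k i • δ i`, one more `∂` costs one more `δ` and an undifferentiated entry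
      -- of `T`, which level `n + 1` always contains.
      · rw [sum_mul_gaugeD hT]
        refine sum_mem fun i _ => mul_mem ?_ ?_
        · exact hSN _ _ (Or.inl ⟨k, i, 0, by simp, by simp⟩)
        · rw [← iterD_add_single hcomm']
          exact hSN _ _ (Or.inr ⟨s, _, by simpa using h, rfl⟩)
  have hN0 : a ∈ N 0 := by
    refine IntermediateField.adjoin.mono F _ _ ?_ ha
    rintro _ ⟨s, rfl⟩
    exact Or.inr ⟨s, 0, by simp, by simp⟩
  have hiter : ∀ β : Fin m →₀ ℕ, iterD d β a ∈ N β.degree := by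
    intro β
    induction β using exponent_induction with
    | zero => simpa using hN0
    | add β i ih =>
      rw [iterD_add_single hcomm, map_add, Finsupp.degree_single]
      exact hstep _ _ _ ih
  have hNM : N β.degree ≤ M := by
    refine IntermediateField.adjoin_le_iff.2 fun b hb => ?_
    rcases hSmono _ _ hβ hb with ⟨i, j, β, h, rfl⟩ | ⟨s, α, h, rfl⟩
    · exact hMT _ _ _ h
    · exact hMy _ _ h
  exact hNM (hiter β)

end Filtration

/-! ### Jets of the generic matrix -/

section Generic

variable {F : Type*} [Field F] {m : ℕ} {l : ℕ}

theorem derivation_genericField_ext {D₁ D₂ : Derivation ℤ (GenericField F m l) (GenericField F m l)}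
    (h : ∀ r, D₁ (algebraMap (GenericRing F m l) _ (toGeneric F m l r)) =
      D₂ (algebraMap (GenericRing F m l) _ (toGeneric F m l r))) : D₁ = D₂ := by
  refine Derivation.ext fun a => ?_
  obtain ⟨r, s, -, rfl⟩ := IsFractionRing.div_surjective (A := GenericRing F m l) a
  obtain ⟨r, rfl⟩ := toGeneric_surjective F m l r
  obtain ⟨s, rfl⟩ := toGeneric_surjective F m l s
  rw [Derivation.leibniz_div, Derivation.leibniz_div, h, h]

theorem diffPoly_derivation_ext {σ : Type*} {D₁ D₂ : Derivation ℤ (DiffPoly F m σ) (DiffPoly F m σ)}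
    (hC : ∀ a, D₁ (MvPolynomial.C a) = D₂ (MvPolynomial.C a))
    (hX : ∀ v, D₁ (MvPolynomial.X v) = D₂ (MvPolynomial.X v)) : D₁ = D₂ := by
  refine Derivation.ext fun p => ?_
  induction p using MvPolynomial.induction_on with
  | C a => exact hC a
  | add p q hp hq => rw [map_add, map_add, hp, hq]
  | mul_X p v hp => rw [Derivation.leibniz, Derivation.leibniz, hp, hX]

/-- The commutator is again a derivation, so it suffices that it vanishes on constants and
variables. -/
theorem DiffPoly.D_comm {σ : Type*} {d : Fin m → Derivation ℤ F F}
    (hcomm : ∀ i j a, d i (d j a) = d j (d i a)) (i j : Fin m) (p : DiffPoly F m σ) :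
    DiffPoly.D σ d i (DiffPoly.D σ d j p) = DiffPoly.D σ d j (DiffPoly.D σ d i p) := by
  have h : ⁅DiffPoly.D σ d i, DiffPoly.D σ d j⁆ = 0 := by
    apply diffPoly_derivation_ext
    · intro a
      simp [Derivation.commutator_apply, hcomm i j a]
    · intro v
      simp [Derivation.commutator_apply, add_right_comm]
  rw [← sub_eq_zero, ← Derivation.commutator_apply, h, Derivation.zero_apply]

variable {d : Fin m → Derivation ℤ F F}

theorem genericD_comm (hcomm : ∀ i j a, d i (d j a) = d j (d i a)) (i j : Fin m)
    (a : GenericField F m l) :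
    genericD l d i (genericD l d j a) = genericD l d j (genericD l d i a) := by
  have h : ⁅genericD l d i, genericD l d j⁆ = 0 := by
    apply derivation_genericField_ext
    intro r
    rw [Derivation.commutator_apply, genericD_apply, genericD_apply, genericD_apply,
      genericD_apply, DiffPoly.D_comm hcomm, sub_self, Derivation.zero_apply]
  rw [← sub_eq_zero, ← Derivation.commutator_apply, h, Derivation.zero_apply]

theorem iterD_genericVar (hcomm : ∀ i j a, d i (d j a) = d j (d i a))
    (s : (Fin m × Fin m) ⊕ Fin l) (β : Fin m →₀ ℕ) :
    iterD (genericD l d) β (genericVar F m l s) =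
      algebraMap (GenericRing F m l) (GenericField F m l)
        (toGeneric F m l (MvPolynomial.X (s, β))) := by
  induction β using exponent_induction with
  | zero => rw [iterD_zero, genericVar]
  | add β i ih => rw [iterD_add_single (genericD_comm hcomm), ih, genericD_apply, DiffPoly.D_X]

/-- Indices of the derivatives of positive order of the potentials of `T` and of all
derivatives of the remaining indeterminates. -/
abbrev JetIndex (m l : ℕ) : Type :=
  {v : (Fin m ⊕ Fin l) × (Fin m →₀ ℕ) // ∀ j, v.1 = Sum.inl j → v.2 ≠ 0}

/-- The family given by `H j γ` at the derivatives of the potentials and by `u q β` at the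
derivatives of the remaining indeterminates. -/
noncomputable def jetFamily {A : Type*} (H : Fin m → (Fin m →₀ ℕ) → A) (u : Fin l → (Fin m →₀ ℕ) → A)
    (v : (Fin m ⊕ Fin l) × (Fin m →₀ ℕ)) : A :=
  Sum.elim (fun j => H j v.2) (fun q => u q v.2) v.1

/-- The number of derivations applied to an entry of `T` or to one of the remaining
indeterminates. -/
noncomputable def jetWeight (v : (Fin m ⊕ Fin l) × (Fin m →₀ ℕ)) : ℕ :=
  Sum.elim (fun _ => v.2.degree - 1) (fun _ => v.2.degree) v.1

theorem finite_jetWeight_le (n : ℕ) : {v : JetIndex m l | jetWeight v.1 ≤ n}.Finite := by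
  have h : ((Set.univ : Set (Fin m ⊕ Fin l)) ×ˢ {α : Fin m →₀ ℕ | α.degree ≤ n + 1}).Finite :=
    Set.finite_univ.prod (Finsupp.finite_of_degree_le (n + 1))
  refine Set.Finite.subset (h.preimage Subtype.val_injective.injOn) ?_
  rintro ⟨⟨j | q, α⟩, hv⟩ h
  · have h' : α.degree - 1 ≤ n := h
    exact ⟨trivial, show α.degree ≤ n + 1 by omega⟩
  · have h' : α.degree ≤ n := h
    exact ⟨trivial, show α.degree ≤ n + 1 by omega⟩

/-- `potential` embeds the generic ring into a polynomial ring and carries these jets to distinct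
variables. The potentials themselves need not exist in the generic field; only their derivatives of
positive order are used. -/
theorem exists_jetFamily_generic (hcomm : ∀ i j a, d i (d j a) = d j (d i a)) :
    ∃ H : Fin m → (Fin m →₀ ℕ) → GenericField F m l,
      (∀ i j β, H j (β + Finsupp.single i 1) = iterD (genericD l d) β (genericT F m l i j)) ∧
      AlgebraicIndependent F (fun v : JetIndex m l =>
        jetFamily H (fun q β => iterD (genericD l d) β (generict F m l q)) v.1) := by
  have hpot : ∀ j : Fin m, ∃ H : (Fin m →₀ ℕ) → GenericRing F m l, ∀ i β,
      H (β + Finsupp.single i 1) = toGeneric F m l (MvPolynomial.X (Sum.inl (i, j), β)) :=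
    fun j =>
      letI : Inhabited (GenericRing F m l) := ⟨0⟩
      exists_potential
        (fun i β => toGeneric F m l (MvPolynomial.X (Sum.inl (i, j), β)))
        (fun i k β => (toGeneric_eq_iff _ _).2 (Ideal.subset_span ⟨i, j, k, β, rfl⟩))
  choose H hH using hpot
  refine ⟨fun j γ => algebraMap _ _ (H j γ), fun i j β => ?_, ?_⟩
  · change algebraMap _ _ (H j _) = _
    rw [hH]
    exact (iterD_genericVar hcomm _ _).symm
  · let ι : GenericRing F m l →ₐ[F] DiffPoly F m (Fin m ⊕ Fin l) :=
      Ideal.Quotient.liftₐ (relIdeal F m l) (potential F m l)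
        (fun a ha => by rwa [← ker_potential, RingHom.mem_ker] at ha)
    have hι : ∀ r, ι (toGeneric F m l r) = potential F m l r := fun r => rfl
    let x : JetIndex m l → GenericRing F m l := fun v =>
      jetFamily H (fun q β => toGeneric F m l (MvPolynomial.X (Sum.inr q, β))) v.1
    have hx : AlgebraicIndependent F x := by
      apply AlgebraicIndependent.of_comp ι
      have : ι ∘ x = fun v : JetIndex m l => MvPolynomial.X v.1 := by
        funext v
        obtain ⟨⟨j | q, α⟩, hv⟩ := v
        · rcases exponent_eq_zero_or α with rfl | ⟨β, i, rfl⟩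
          · exact absurd rfl (hv j rfl)
          · change ι (H j (β + Finsupp.single i 1)) = _
            rw [hH, hι, potential, MvPolynomial.aeval_X]
        · change ι (toGeneric F m l _) = _
          rw [hι, potential, MvPolynomial.aeval_X]
      rw [this]
      exact (MvPolynomial.algebraicIndependent_X _ F).comp _ Subtype.val_injective
    have hx' := hx.map' (f := IsScalarTower.toAlgHom F (GenericRing F m l) (GenericField F m l))
      (IsFractionRing.injective (GenericRing F m l) (GenericField F m l))
    convert hx' using 2 with v
    obtain ⟨⟨j | q, α⟩, hv⟩ := v
    · rfl
    · exact iterD_genericVar hcomm _ _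

theorem algebraicIndependent_of_jet_mem {x z : JetIndex m l → GenericField F m l}
    (hx : AlgebraicIndependent F x)
    (h : ∀ v, x v ∈ IntermediateField.adjoin F (z '' {u | jetWeight u.1 ≤ jetWeight v.1})) :
    AlgebraicIndependent F z :=
  algebraicIndependent_of_mem_adjoin_of_weight hx (fun v => jetWeight v.1) finite_jetWeight_le h

/-- A differential polynomial is an ordinary polynomial in the derivatives, so independence of these
as a subfamily of `z` suffices. -/
theorem eval_ne_zero_of_algebraicIndependent {K ι σ : Type*} [CommRing K] [Algebra F K]
    {δ : Fin m → Derivation ℤ K K} {y : σ → K} {z : ι → K} (hz : AlgebraicIndependent F z)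
    (f : σ × (Fin m →₀ ℕ) → ι) (hf : Function.Injective f)
    (hzf : ∀ s α, z (f (s, α)) = iterD δ α (y s)) {p : DiffPoly F m σ} (hp : p ≠ 0) :
    DiffPoly.eval δ y p ≠ 0 := by
  intro h
  refine hp ((hz.comp f hf).eq_zero_of_aeval_eq_zero p ?_)
  rw [← h, DiffPoly.eval]
  congr 2
  funext v
  exact hzf v.1 v.2

/-- The index of the derivative of the `k`-th row of `T`. -/
noncomputable def rowIndex (l : ℕ) (k : Fin m) (v : (Fin m ⊕ Fin l) × (Fin m →₀ ℕ)) : JetIndex m l :=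
  ⟨(v.1, Sum.elim (fun _ => v.2 + Finsupp.single k 1) (fun _ => v.2) v.1), by
    rintro j hj
    have hj' : v.1 = Sum.inl j := hj
    simp [hj']⟩

theorem rowIndex_injective (k : Fin m) : Function.Injective (rowIndex l k) := by
  rintro ⟨j | q, α⟩ ⟨j' | q', α'⟩ h
  all_goals have h := congrArg Subtype.val h
  · simpa [rowIndex] using h
  · simp [rowIndex] at h
  · simp [rowIndex] at h
  · simpa [rowIndex] using h

end Generic

/-! ### Independent families of derivatives with respect to `T⁻¹∂` -/

section Independence

variable {F : Type*} [Field F] {m : ℕ} {l : ℕ} {d : Fin m → Derivation ℤ F F}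

theorem genericGaugeD_comm (hcomm : ∀ i j a, d i (d j a) = d j (d i a)) (i j : Fin m)
    (a : GenericField F m l) :
    gaugeD (genericT F m l) (genericD l d) i (gaugeD (genericT F m l) (genericD l d) j a) =
      gaugeD (genericT F m l) (genericD l d) j (gaugeD (genericT F m l) (genericD l d) i a) :=
  gaugeD_comm (genericT_det_ne_zero F m l) (genericD_genericT d) (genericD_comm hcomm) i j a

/-- The field generated by the members of `z` of weight at most `n`. -/
noncomputable def jetField (z : JetIndex m l → GenericField F m l) (n : ℕ) :
    IntermediateField F (GenericField F m l) :=
  IntermediateField.adjoin F (z '' {u | jetWeight u.1 ≤ n})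

theorem jetField_mono (z : JetIndex m l → GenericField F m l) {p q : ℕ} (h : p ≤ q) :
    jetField z p ≤ jetField z q := by
  refine IntermediateField.adjoin.mono F _ _ (Set.image_mono ?_)
  intro u hu
  exact le_trans hu h

theorem mem_jetField (z : JetIndex m l → GenericField F m l) (v : JetIndex m l) :
    z v ∈ jetField z (jetWeight v.1) :=
  IntermediateField.subset_adjoin F _ ⟨v, le_refl (jetWeight v.1), rfl⟩

theorem jetWeight_rowIndex (k : Fin m) (s : Fin m ⊕ Fin l) (α : Fin m →₀ ℕ) :
    jetWeight (rowIndex l k (s, α)).1 = α.degree := by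
  rcases s with j | q <;> simp [jetWeight, rowIndex]

theorem matrix_inv_apply_mem {F K : Type*} [Field F] [Field K] [Algebra F K] {n : Type*}
    [Fintype n] [DecidableEq n] (L : IntermediateField F K) {A : Matrix n n K}
    (hA : ∀ i j, A i j ∈ L) (i j : n) : A⁻¹ i j ∈ L := by
  let B : Matrix n n L := Matrix.of fun i j => ⟨A i j, hA i j⟩
  have hB : L.val.toRingHom.mapMatrix B = A := rfl
  rw [Matrix.inv_def, Ring.inverse_eq_inv', Matrix.smul_apply, smul_eq_mul]
  refine mul_mem (inv_mem ?_) ?_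
  · rw [← hB, ← RingHom.map_det]
    exact B.det.2
  · rw [← hB, ← RingHom.map_adjugate]
    exact (B.adjugate i j).2

/-- A family indexed by jets is algebraically independent as soon as it contains, in the sense of
generated fields and with control of the order, the derivatives of elements `y s` with respect to
`T⁻¹ ∂`, where the `y s` generate enough of the generic field. -/
theorem algebraicIndependent_of_gaugeD_mem {σ : Type*}
    (hcomm : ∀ i j a, d i (d j a) = d j (d i a))
    (z : JetIndex m l → GenericField F m l) (y : σ → GenericField F m l)
    (hy : ∀ s α, iterD (gaugeD (genericT F m l) (genericD l d)) α (y s) ∈ jetField z α.degree)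
    (ht : ∀ q, generict F m l q ∈ IntermediateField.adjoin F (Set.range y))
    (hT : ∀ i j β, iterD (genericD l d) β (genericT F m l i j) ∈ jetField z β.degree ∨
      ∃ a ∈ IntermediateField.adjoin F (Set.range y), ∃ β', β'.degree = β.degree ∧
        iterD (genericD l d) β (genericT F m l i j) = iterD (genericD l d) β' a) :
    AlgebraicIndependent F z := by
  have hmem : ∀ n, (∀ i j β, β.degree < n →
      iterD (genericD l d) β (genericT F m l i j) ∈ jetField z n) →
      ∀ a ∈ IntermediateField.adjoin F (Set.range y), ∀ β, β.degree ≤ n →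
        iterD (genericD l d) β a ∈ jetField z n := fun n hn a ha β hβ =>
    iterD_mem_of_gaugeD (fun k a => ⟨d k a, genericD_algebraMap d k a⟩)
      (genericT_det_ne_zero F m l) (genericD_comm hcomm) (genericGaugeD_comm hcomm) y
      (jetField z n) n hn (fun s α hα => jetField_mono z hα (hy s α)) ha β hβ
  have hTmem : ∀ n i j β, β.degree = n →
      iterD (genericD l d) β (genericT F m l i j) ∈ jetField z n := by
    intro n
    induction n using Nat.strong_induction_on with
    | _ n ih =>
      rintro i j β rfl
      rcases hT i j β with h | ⟨a, ha, β', hβ, h⟩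
      · exact h
      -- The comparison of orders needs only derivatives of `T` of order below that of `β`, which
      -- the induction hypothesis supplies.
      · rw [h]
        exact hmem _ (fun i j γ hγ => jetField_mono z hγ.le (ih _ hγ i j γ rfl)) a ha β' hβ.le
  obtain ⟨H, hH, hx⟩ := exists_jetFamily_generic (l := l) hcomm
  refine algebraicIndependent_of_jet_mem hx ?_
  rintro ⟨⟨j | q, α⟩, hv⟩
  · rcases exponent_eq_zero_or α with rfl | ⟨β, i, rfl⟩
    · exact absurd rfl (hv j rfl)
    · change H j (β + Finsupp.single i 1) ∈
        jetField z ((β + Finsupp.single i 1 : Fin m →₀ ℕ).degree - 1)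
      rw [hH, map_add, Finsupp.degree_single, Nat.add_sub_cancel]
      exact hTmem _ i j β rfl
  · exact hmem α.degree (fun i j β hβ => jetField_mono z hβ.le (hTmem _ i j β rfl)) _ (ht q) α
      le_rfl

/-- The family consists of the jets of the `T⁻¹∂`-potentials of the columns of `T⁻¹`. It determines
`x` because `T` is rational in the entries of `T⁻¹`. -/
theorem exists_algebraicIndependent_inv (hcomm : ∀ i j a, d i (d j a) = d j (d i a)) :
    ∃ z : JetIndex m l → GenericField F m l, AlgebraicIndependent F z ∧
      ∀ k s α, z (rowIndex l k (s, α)) =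
        iterD (gaugeD (genericT F m l) (genericD l d)) α
          (Sum.elim ((genericT F m l)⁻¹ k) (generict F m l) s) := by
  have hdet := genericT_det_ne_zero F m l
  have hpot : ∀ j : Fin m, ∃ G : (Fin m →₀ ℕ) → GenericField F m l, ∀ i β,
      G (β + Finsupp.single i 1) =
        iterD (gaugeD (genericT F m l) (genericD l d)) β ((genericT F m l)⁻¹ i j) :=
    fun j =>
      letI : Inhabited (GenericField F m l) := ⟨0⟩
      exists_potential
        (fun i β => iterD (gaugeD (genericT F m l) (genericD l d)) β ((genericT F m l)⁻¹ i j))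
        (fun i k β => iterD_integrability (genericGaugeD_comm hcomm)
          (gaugeD_inv_apply hdet (genericD_genericT d) k i j) β)
  choose G hG using hpot
  let z : JetIndex m l → GenericField F m l := fun v => jetFamily G
    (fun q β => iterD (gaugeD (genericT F m l) (genericD l d)) β (generict F m l q)) v.1
  have hz : ∀ k s α, z (rowIndex l k (s, α)) =
      iterD (gaugeD (genericT F m l) (genericD l d)) α
        (Sum.elim ((genericT F m l)⁻¹ k) (generict F m l) s) := by
    rintro k (j | q) α
    · exact hG j k α
    · rfl
  let y : (Fin m × Fin m) ⊕ Fin l → GenericField F m l :=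
    Sum.elim (fun e => (genericT F m l)⁻¹ e.1 e.2) (generict F m l)
  have hinv : ∀ i j, (genericT F m l)⁻¹ i j ∈ IntermediateField.adjoin F (Set.range y) :=
    fun i j => IntermediateField.subset_adjoin F _ ⟨Sum.inl (i, j), rfl⟩
  have hTy : ∀ i j, genericT F m l i j ∈ IntermediateField.adjoin F (Set.range y) := by
    intro i j
    rw [← Matrix.nonsing_inv_nonsing_inv (genericT F m l) (isUnit_iff_ne_zero.2 hdet)]
    exact matrix_inv_apply_mem _ hinv i j
  refine ⟨z, ?_, hz⟩
  refine algebraicIndependent_of_gaugeD_mem hcomm z y ?_ ?_ ?_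
  · rintro (⟨i, j⟩ | q) α
    · have := mem_jetField z (rowIndex l i (Sum.inl j, α))
      rwa [hz, jetWeight_rowIndex] at this
    · exact mem_jetField z ⟨(Sum.inr q, α), by simp⟩
  · exact fun q => IntermediateField.subset_adjoin F _ ⟨Sum.inr q, rfl⟩
  · exact fun i j β => Or.inr ⟨_, hTy i j, β, rfl, rfl⟩

theorem exists_algebraicIndependent_row (hcomm : ∀ i j a, d i (d j a) = d j (d i a))
    (k : Fin m) :
    ∃ z : JetIndex m l → GenericField F m l, AlgebraicIndependent F z ∧
      ∀ s α, z (rowIndex l k (s, α)) =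
        iterD (gaugeD (genericT F m l) (genericD l d)) α
          (Sum.elim (genericT F m l k) (generict F m l) s) := by
  classical
  obtain ⟨H, hH, -⟩ := exists_jetFamily_generic (l := l) hcomm
  -- Jets of `s_j` involving `∂ₖ` are derivatives of `t_kj` and are replaced by the corresponding
  -- `T⁻¹∂`-derivatives; jets not involving `∂ₖ` stay as they are.
  let z : JetIndex m l → GenericField F m l := fun v => jetFamily
    (fun j γ => if γ k = 0 then H j γ else
      iterD (gaugeD (genericT F m l) (genericD l d)) (γ - Finsupp.single k 1)
        (genericT F m l k j))
    (fun q β => iterD (gaugeD (genericT F m l) (genericD l d)) β (generict F m l q)) v.1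
  have hz : ∀ s α, z (rowIndex l k (s, α)) =
      iterD (gaugeD (genericT F m l) (genericD l d)) α
        (Sum.elim (genericT F m l k) (generict F m l) s) := by
    rintro (j | q) α
    · simp [z, rowIndex, jetFamily]
    · rfl
  let y : Fin m ⊕ Fin l → GenericField F m l := Sum.elim (genericT F m l k) (generict F m l)
  refine ⟨z, ?_, hz⟩
  refine algebraicIndependent_of_gaugeD_mem hcomm z y ?_ ?_ ?_
  · intro s α
    have := mem_jetField z (rowIndex l k (s, α))
    rwa [hz, jetWeight_rowIndex] at this
  · exact fun q => IntermediateField.subset_adjoin F _ ⟨Sum.inr q, rfl⟩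
  · intro i j β
    -- As a jet of `s_j`, the derivative `∂^β t_ij` either avoids `∂ₖ`, and is then a member of `z`,
    -- or equals `∂^β' t_kj` with `β + eᵢ = β' + eₖ`, a derivative of the same order of an entry of
    -- row `k`.
    by_cases h : (β + Finsupp.single i 1 : Fin m →₀ ℕ) k = 0
    · left
      have h1 := mem_jetField z (rowIndex l i (Sum.inl j, β))
      have h2 : z (rowIndex l i (Sum.inl j, β)) =
          iterD (genericD l d) β (genericT F m l i j) := by
        rw [← hH]
        exact if_pos h
      rwa [h2, jetWeight_rowIndex] at h1
    · right
      have hle : Finsupp.single k 1 ≤ (β + Finsupp.single i 1 : Fin m →₀ ℕ) := by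
        rw [Finsupp.single_le_iff]
        omega
      obtain ⟨β', hβ'⟩ := exists_add_of_le hle
      refine ⟨genericT F m l k j,
        IntermediateField.subset_adjoin F _ ⟨Sum.inl j, rfl⟩, β', ?_, ?_⟩
      · have := congrArg Finsupp.degree hβ'
        rw [map_add, map_add, Finsupp.degree_single, Finsupp.degree_single] at this
        omega
      · rw [← hH, ← hH, hβ', add_comm]

end Independence

end DiffAlg

/-! ### The three nonvanishing statements -/

theorem corollary2p9 {F : Type*} [Field F] [CharZero F] (m l : ℕ) [NeZero m]
    (d : Fin m → Derivation ℤ F F)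
    (hcomm : ∀ i j a, d i (d j a) = d j (d i a))
    (hlin : LinearIndependent F d)
    (p : DiffAlg.DiffPoly F m (Fin m ⊕ Fin l)) (hp : p ≠ 0) :
    DiffAlg.DiffPoly.eval (DiffAlg.genericD l d)
      (Sum.elim (Pi.single 0 1 ᵥ* DiffAlg.genericT F m l) (DiffAlg.generict F m l)) p ≠ 0 ∧
    DiffAlg.DiffPoly.eval (DiffAlg.gaugeD (DiffAlg.genericT F m l) (DiffAlg.genericD l d))
      (Sum.elim (Pi.single 0 1 ᵥ* (DiffAlg.genericT F m l)⁻¹) (DiffAlg.generict F m l)) p ≠ 0 ∧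
    DiffAlg.DiffPoly.eval (DiffAlg.gaugeD (DiffAlg.genericT F m l) (DiffAlg.genericD l d))
      (Sum.elim (Pi.single 0 1 ᵥ* DiffAlg.genericT F m l) (DiffAlg.generict F m l)) p ≠ 0 := by
  rw [Matrix.single_one_vecMul, Matrix.single_one_vecMul]
  refine ⟨?_, ?_, ?_⟩
  · obtain ⟨H, hH, hx⟩ := DiffAlg.exists_jetFamily_generic (l := l) hcomm
    refine DiffAlg.eval_ne_zero_of_algebraicIndependent hx (DiffAlg.rowIndex l 0)
      (DiffAlg.rowIndex_injective 0) ?_ hp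
    rintro (j | q) α
    · exact hH 0 j α
    · rfl
  · obtain ⟨z, hz, h⟩ := DiffAlg.exists_algebraicIndependent_inv (l := l) hcomm
    exact DiffAlg.eval_ne_zero_of_algebraicIndependent hz (DiffAlg.rowIndex l 0)
      (DiffAlg.rowIndex_injective 0) (h 0) hp
  · obtain ⟨z, hz, h⟩ := DiffAlg.exists_algebraicIndependent_row (l := l) hcomm 0
    exact DiffAlg.eval_ne_zero_of_algebraicIndependent hz (DiffAlg.rowIndex l 0)
      (DiffAlg.rowIndex_injective 0) h hp
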